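/- **Setting.** A problem class $\mathcal P=(\mathsf X,\mathcal F,\mathcal O)$ consists of a compact convex set $\mathsf X\subset\mathbb R^n$, a set $\mathcal F\subset C(\mathsf X)$ of continuous convex functions $f:\mathsf X\to\mathbb R$ (with the Borel $\sigma$-field of the sup norm), and an oracle, i.e. a standard Borel space $\mathsf Y$ with a Markov kernel $P(dy|f,x)$ from $\mathcal F\times\mathsf X$ to $\mathsf Y$. Write $f^*=\inf_{x\in\mathsf X}f(x)$. A $T$-step algorithm is a sequence of measurable maps $\mathcal A_t:\mathsf X^{t-1}\times\mathsf Y^{t-1}\to\mathsf X$, $1\le t\le T+1$; on $f\in\mathcal F$ it produces $X_t=\mathcal A_t(X^{t-1},Y^{t-1})$ for $1\le t\le T+1$, where $Y_t\sim P(\cdot|f,X_t)$ given the past for $t\le T$, and its error is $\operatorname{err}_{\mathcal A}(T,f)=f(X_{T+1})-f^*$. For $r\ge1$, $\varepsilon>0$ and $\delta\in(0,1)$ let $$K^{(r)}_{\mathcal P}(\varepsilon,\delta)=\inf\Big\{T\ge1:\ \exists\ T\text{-step }\mathcal A\text{ with }\sup_{f\in\mathcal F}\Pr\big(\operatorname{err}_{\mathcal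 A}^r(T,f)\ge\varepsilon\big)\le\delta\Big\},$$ $$K^{(r)}_{\mathcal P}(\varepsilon)=\inf\Big\{T\ge1:\ \exists\ T\text{-step }\mathcal A\text{ with }\sup_{f\in\mathcal F}\mathbb E\operatorname{err}_{\mathcal A}^r(T,f)<\varepsilon\Big\},$$ with $\inf\emptyset=\infty$. Suppose that the oracle is realized as $Y=\Phi(\psi(f,x),W)$, where $W$ is uniform on $[0,1]$, $\psi:\mathcal F\times\mathsf X\to\mathsf U$ and $\Phi:\mathsf U\times[0,1]\to\mathsf Y$ are measurable, and $\mathsf U$ is a standard Borel space. Let $$C^*=\sup_U I(U;Y)\in[0,\infty],\qquad Y=\Phi(U,W),$$ where the supremum is over all random variables $U$ with values in $\psi(\mathcal F,\mathsf X)$ that are independent of $W$, and $I$ is mutual information in nats. Let $d:\mathcal F\times\mathcal F\to\mathbb R$ be any function such that, for all $f,g\in\mathcal F$, $x\in\mathsf X$ and $\varepsilon>0$, $$d(f,g)\ge2\varepsilon\ \text{ and }\ f(x)<f^*+\varepsilon\quad\Longrightarrow\quad g(x)>g^*+\varepsilon,$$ and let $N(\mathcal F,d,\eta)\in\mathbb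 N\cup\{\infty\}$ be the supremum of the $N\ge1$ for which there are $f_0,\dots,f_{N-1}\in\mathcal F$ with $d(f_i,f_j)\ge2\eta$ for all $i\ne j$. **Theorem.** For every $r\ge1$, every $\varepsilon>0$ with $N(\mathcal F,d,\varepsilon^{1/r})>4$, and every $\delta\in(0,1/2)$, $$K^{(r)}_{\mathcal P}(\varepsilon,\delta)\ \ge\ \frac1{C^*}\Big[(1-\delta)\log N(\mathcal F,d,\varepsilon^{1/r})-\log2\Big],$$ $$K^{(r)}_{\mathcal P}(\varepsilon)\ \ge\ \frac1{C^*}\Big[\tfrac23\log N(\mathcal F,d,(3\varepsilon)^{1/r})-\log2\Big].$$ Here a negative bracket is replaced by $0$, $\log\infty=\infty$, a positive bracket divided by $C^*=0$ is $\infty$, and the right-hand sides are $0$ if $C^*=\infty$ or if the bracket is $0$. Consequently there are universal constants $c>0$ and $\varepsilon_0\in(0,1)$ such that for every $n$, every problem class with $\mathsf X=[-1,1]^n$ and $\mathcal F$ the set of all convex functions on $\mathsf X$ that are $1$-Lipschitz in the Euclidean norm, and every oracle realized as above with capacity $C^*$, $$K^{(1)}_{\mathcal P}(\varepsilon)\ \ge\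 \frac{c\,n\log(1/\varepsilon)}{C^*}\qquad\text{for all }0<\varepsilon\le\varepsilon_0.$$ -/

import Mathlib

open MeasureTheory ProbabilityTheory InformationTheory Set
open scoped ENNReal unitInterval

noncomputable section

/-- The space of continuous real functions (with the topology of uniform convergence when the
domain is compact) carries its Borel sigma-algebra. -/
instance instMeasurableSpaceContinuousMapReal {X : Type*} [TopologicalSpace X] :
    MeasurableSpace C(X, ℝ) := borel _

instance instBorelSpaceContinuousMapReal {X : Type*} [TopologicalSpace X] :
    BorelSpace C(X, ℝ) := ⟨rfl⟩

/-- Convexity of a function that is only defined on a (convex) subset `X` of `ℝⁿ`. -/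
def IsConvexFun {n : ℕ} {X : Set (EuclideanSpace ℝ (Fin n))} (f : X → ℝ) : Prop :=
  ∀ (x y z : X) (a b : ℝ), 0 ≤ a → 0 ≤ b → a + b = 1 →
    (z : EuclideanSpace ℝ (Fin n)) = a • (x : EuclideanSpace ℝ (Fin n)) + b • (y : _) →
    f z ≤ a * f x + b * f y

/-- A problem class: a compact convex domain in `ℝⁿ`, a class of continuous convex functions on
it, and an oracle with information space `Y`, i.e. a Markov kernel `P(dy | f, x)`. -/
structure ProblemClass (n : ℕ) (Y : Type*) [MeasurableSpace Y] where
  domain : Set (EuclideanSpace ℝ (Fin n))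
  isCompact_domain : IsCompact domain
  convex_domain : Convex ℝ domain
  instances : Set C(domain, ℝ)
  convex_instances : ∀ f ∈ instances, IsConvexFun f
  oracle : Kernel (instances × domain) Y
  isMarkov_oracle : IsMarkovKernel oracle

namespace ProblemClass

attribute [instance] isMarkov_oracle

variable {n : ℕ} {Y : Type*} [MeasurableSpace Y] (P : ProblemClass n Y)

/-- The minimum `f^* = inf_{x} f(x)` over the domain. -/
def minVal (f : P.instances) : ℝ := ⨅ x : P.domain, f.1 x

/-- The error `f(x) - f^*` of the candidate minimizer `x`. -/
def err (f : P.instances) (x : P.domain) : ℝ := f.1 x - P.minVal f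

/-- The separation property of a distance-like function on the instance space: an
`ε`-minimizer of `f` is not an `ε`-minimizer of any `g` with `d f g ≥ 2 ε`. -/
def IsSeparating (d : P.instances → P.instances → ℝ) : Prop :=
  ∀ (f g : P.instances) (x : P.domain) (ε : ℝ), 0 < ε →
    2 * ε ≤ d f g → f.1 x < P.minVal f + ε → P.minVal g + ε < g.1 x

/-- A deterministic `T`-step algorithm. `step t` (with `t = 0, …, T`) maps the first `t`
query-response pairs to the next query if `t < T`, and to the candidate minimizer if `t = T`. -/
structure Algorithm (T : ℕ) where
  step : (t : Fin (T + 1)) → (Fin (t : ℕ) → P.domain × Y) → P.domain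
  measurable_step : ∀ t, Measurable (step t)

variable {P}

namespace Algorithm

variable {T : ℕ} (A : P.Algorithm T) (f : P.instances)

/-- The law of the oracle's response to the query issued after the history `h`. -/
def response (t : ℕ) (ht : t < T + 1) : Kernel (Fin t → P.domain × Y) Y :=
  P.oracle.comap (fun h => (f, A.step ⟨t, ht⟩ h))
    (measurable_const.prodMk (A.measurable_step ⟨t, ht⟩))

instance isMarkovKernel_response (t : ℕ) (ht : t < T + 1) :
    IsMarkovKernel (A.response f t ht) := by
  unfold response; infer_instance

/-- The law of the first `t` query-response pairs when the algorithm `A` interacts with the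
oracle and the instance is `f`. -/
def historyLaw : (t : ℕ) → t ≤ T → Measure (Fin t → P.domain × Y)
  | 0, _ => Measure.dirac (fun i => i.elim0)
  | t + 1, ht =>
    ((historyLaw t (by omega)) ⊗ₘ (A.response f t (by omega))).map
      (fun p => Fin.snoc (α := fun _ => P.domain × Y) p.1 (A.step ⟨t, by omega⟩ p.1, p.2))

/-- The law of the candidate minimizer produced after `T` queries. -/
def outputLaw : Measure P.domain :=
  (A.historyLaw f T le_rfl).map (A.step (Fin.last T))

end Algorithm

variable (P)

/-- The `r`-th order `(ε, δ)`-complexity (it is `∞` if no algorithm qualifies). -/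
def probComplexity (r ε δ : ℝ) : ℕ∞ :=
  ⨅ (T : ℕ) (_ : 1 ≤ T ∧ ∃ A : P.Algorithm T,
    ⨆ f : P.instances, A.outputLaw f {x | ε ≤ P.err f x ^ r} ≤ ENNReal.ofReal δ), (T : ℕ∞)

/-- The `r`-th order `ε`-complexity (it is `∞` if no algorithm qualifies). -/
def meanComplexity (r ε : ℝ) : ℕ∞ :=
  ⨅ (T : ℕ) (_ : 1 ≤ T ∧ ∃ A : P.Algorithm T,
    ⨆ f : P.instances, ∫⁻ x, ENNReal.ofReal (P.err f x ^ r) ∂(A.outputLaw f) < ENNReal.ofReal ε),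
    (T : ℕ∞)

/-- A realization `Y = Φ(ψ(f, x), W)` of the oracle, with `W` uniform on `[0, 1]`. -/
structure Realization (U : Type*) [MeasurableSpace U] where
  ψ : P.instances × P.domain → U
  measurable_ψ : Measurable ψ
  Φ : U × I → Y
  measurable_Φ : Measurable Φ
  oracle_eq : ∀ z, P.oracle z = (volume : Measure I).map (fun w => Φ (ψ z, w))

end ProblemClass

/-- The mutual information of a pair of random variables with joint law `ρ`. -/
def mutualInfo {α β : Type*} [MeasurableSpace α] [MeasurableSpace β] (ρ : Measure (α × β)) :
    ℝ≥0∞ :=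
  klDiv ρ (ρ.fst.prod ρ.snd)

/-- The Shannon capacity `sup I(U; Y)` of the random transformation `Y = Φ(U, W)`, where `W` is
uniform on `[0, 1]` and independent of `U`, and where `U` takes its values in the range of `ψ`
(`μ` is the law of `U`). -/
def ProblemClass.Realization.capacity {n : ℕ} {Y : Type*} [MeasurableSpace Y]
    {P : ProblemClass n Y} {U : Type*} [MeasurableSpace U] (R : P.Realization U) : ℝ≥0∞ :=
  ⨆ (μ : Measure (range R.ψ)) (_ : IsProbabilityMeasure μ),
    mutualInfo ((μ.prod (volume : Measure I)).map
      (fun p : range R.ψ × I => ((p.1 : U), R.Φ ((p.1 : U), p.2))))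

/-- The packing number: the largest `N ≥ 1` such that there are `N` elements at pairwise
distance at least `2 η` (`∞` if there is no largest one). -/
def packingNumber {α : Type*} (d : α → α → ℝ) (η : ℝ) : ℕ∞ :=
  ⨆ (N : ℕ) (_ : 1 ≤ N ∧ ∃ f : Fin N → α, ∀ i j, i ≠ j → 2 * η ≤ d (f i) (f j)), (N : ℕ∞)

/-- The positive part of `a log N - log 2`, equal to `∞` if `N = ∞` and `a > 0`. -/
def fanoBracket (a : ℝ) (N : ℕ∞) : ℝ≥0∞ :=
  ((a : EReal) * ENNReal.log (N : ℝ≥0∞) - (Real.log 2 : EReal)).toENNReal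

end

/-! Optimizing is at least as hard as identifying. For a packing `f i`, separation makes the sets of
`ε^(1/r)`-minimizers disjoint, so the output of a good algorithm decodes `i` with probability at
least `1 - δ`. Under a uniform prior on `N` indices, Fano's inequality
(`fano_le_sum_klDiv_uniformMixture`) forces the output to carry at least `(1 - δ) log N - log 2`
nats about `i`.

Conversely, `T` queries convey at most `T * C*` nats. Information about `i` is the average
divergence of the component laws from their uniform mixture. By the chain rule, one more query adds
the conditional information given the history. For a fixed history the query does not depend on `i`,
so this is the information through the channel for a finitely supported input weighted by the
posterior, hence at most `C*` (`sum_klDiv_compProd_uniformMixture_le`,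
`sum_mul_klDiv_oracle_le_capacity`). Data processing passes from the history to the output.

Markov's inequality reduces the mean bound to `δ = 1/3` at level `3 ε`. On the cube, the distances
to the points of a grid form the hard family. -/

noncomputable section

/-! ### Conditional divergence and a variational bound -/

section Divergence

variable {α β : Type*} [MeasurableSpace α] [MeasurableSpace β]

lemma klDiv_kernel_eq_lintegral_rnDeriv [MeasurableSpace.CountableOrCountablyGenerated α β]
    (κ η : Kernel α β) [IsFiniteKernel κ] [IsFiniteKernel η] {a : α} (h : κ a ≪ η a) :
    klDiv (κ a) (η a) = ∫⁻ y, ENNReal.ofReal (klFun (κ.rnDeriv η a y).toReal) ∂(η a) := by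
  rw [klDiv_eq_lintegral_klFun_of_ac h]
  refine lintegral_congr_ae ?_
  filter_upwards [Kernel.rnDeriv_eq_rnDeriv_measure (κ := κ) (η := η) (a := a)] with y hy
  rw [hy]

/-- The jointly measurable kernel density handles the measurable set where `κ a ≪ η a`; off it the
divergence is `∞`. -/
lemma measurable_klDiv_kernel [MeasurableSpace.CountableOrCountablyGenerated α β]
    (κ η : Kernel α β) [IsFiniteKernel κ] [IsFiniteKernel η] :
    Measurable fun a => klDiv (κ a) (η a) := by
  classical
  have hφ : Measurable fun a =>
      ∫⁻ y, ENNReal.ofReal (klFun (κ.rnDeriv η a y).toReal) ∂(η a) := by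
    refine Measurable.lintegral_kernel_prod_right' (κ := η)
      (f := fun p : α × β => ENNReal.ofReal (klFun (κ.rnDeriv η p.1 p.2).toReal)) ?_
    exact (measurable_klFun.comp (Kernel.measurable_rnDeriv κ η).ennreal_toReal).ennreal_ofReal
  have heq : (fun a => klDiv (κ a) (η a)) = fun a => if κ a ≪ η a then
      ∫⁻ y, ENNReal.ofReal (klFun (κ.rnDeriv η a y).toReal) ∂(η a) else ∞ := by
    ext a
    split_ifs with h
    · exact klDiv_kernel_eq_lintegral_rnDeriv κ η h
    · exact klDiv_of_not_ac h
  rw [heq]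
  exact Measurable.ite (Kernel.measurableSet_absolutelyContinuous κ η) hφ measurable_const

/-- The conditional divergence as an average of divergences. -/
lemma klDiv_compProd_eq_lintegral [MeasurableSpace.CountableOrCountablyGenerated α β]
    (μ : Measure α) [IsFiniteMeasure μ]
    (κ η : Kernel α β) [IsFiniteKernel κ] [IsFiniteKernel η] (h : ∀ᵐ a ∂μ, κ a ≪ η a) :
    klDiv (μ ⊗ₘ κ) (μ ⊗ₘ η) = ∫⁻ a, klDiv (κ a) (η a) ∂μ := by
  have hac : μ ⊗ₘ κ ≪ μ ⊗ₘ η := Measure.AbsolutelyContinuous.compProd_right h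
  have hmeas : Measurable fun p : α × β =>
      ENNReal.ofReal (klFun (κ.rnDeriv η p.1 p.2).toReal) :=
    (measurable_klFun.comp (Kernel.measurable_rnDeriv κ η).ennreal_toReal).ennreal_ofReal
  have hrn : (μ ⊗ₘ κ).rnDeriv (μ ⊗ₘ η) =ᵐ[μ ⊗ₘ η] fun p => κ.rnDeriv η p.1 p.2 := by
    have hwd : μ ⊗ₘ κ = (μ ⊗ₘ η).withDensity fun p => κ.rnDeriv η p.1 p.2 := by
      have hm := Kernel.measurable_rnDeriv κ η
      ext s hs
      rw [withDensity_apply _ hs, ← lintegral_indicator hs,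
        Measure.lintegral_compProd (hm.indicator hs), Measure.compProd_apply hs]
      refine lintegral_congr_ae ?_
      filter_upwards [h] with a ha
      rw [← Kernel.setLIntegral_rnDeriv ha (measurable_prodMk_left hs),
        ← lintegral_indicator (measurable_prodMk_left hs)]
      rfl
    rw [hwd]
    exact Measure.rnDeriv_withDensity _ (Kernel.measurable_rnDeriv κ η)
  rw [klDiv_eq_lintegral_klFun_of_ac hac]
  calc _ = ∫⁻ p, ENNReal.ofReal (klFun (κ.rnDeriv η p.1 p.2).toReal) ∂(μ ⊗ₘ η) := by
        refine lintegral_congr_ae ?_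
        filter_upwards [hrn] with p hp
        rw [hp]
    _ = _ := by
        rw [Measure.lintegral_compProd hmeas]
        refine lintegral_congr_ae ?_
        filter_upwards [h] with a ha
        exact (klDiv_kernel_eq_lintegral_rnDeriv κ η ha).symm

/-- The variational lower bound on the divergence. -/
lemma integral_sub_integral_exp_le_klDiv (p q : Measure α) [IsProbabilityMeasure p]
    [IsProbabilityMeasure q] (hpq : klDiv p q ≠ ∞) {g : α → ℝ} (hg : Measurable g) {B : ℝ}
    (hB : ∀ x, |g x| ≤ B) :
    ∫ x, g x ∂p + 1 - ∫ x, Real.exp (g x) ∂q ≤ (klDiv p q).toReal := by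
  obtain ⟨hac, hint⟩ := klDiv_ne_top_iff.mp hpq
  rw [toReal_klDiv_eq_integral_klFun hac, ← integral_rnDeriv_smul hac]
  have h1 : Integrable (fun x => (p.rnDeriv q x).toReal • g x) q := by
    rw [integrable_rnDeriv_smul_iff hac]
    exact Integrable.of_bound hg.aestronglyMeasurable B (ae_of_all _ hB)
  have h2 : Integrable (fun x => Real.exp (g x)) q := by
    refine Integrable.of_bound (Real.measurable_exp.comp hg).aestronglyMeasurable (Real.exp B)
      (ae_of_all _ fun x => ?_)
    rw [Real.norm_eq_abs, Real.abs_exp]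
    exact Real.exp_le_exp.mpr ((le_abs_self _).trans (hB x))
  have h3 : (1 : ℝ) = ∫ _, (1 : ℝ) ∂q := by simp
  have h4 : Integrable (fun _ : α => (1 : ℝ)) q := integrable_const _
  calc _ = ∫ x, ((p.rnDeriv q x).toReal • g x + 1 - Real.exp (g x)) ∂q := by
        have h5 := integral_sub (h1.add h4) h2
        have h6 := integral_add h1 h4
        simp only [Pi.add_apply] at h5
        rw [h5, h6, ← h3]
    _ ≤ _ := by
        refine integral_mono ((h1.add h4).sub h2)
          ((integrable_klFun_rnDeriv_iff hac).mpr hint) fun x => ?_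
        set t := (p.rnDeriv q x).toReal with ht
        have ht0 : 0 ≤ t := ENNReal.toReal_nonneg
        simp only [smul_eq_mul, klFun]
        rcases ht0.eq_or_lt with h0 | h0
        · rw [← h0]; simp [(Real.exp_pos (g x)).le]
        -- Young's inequality `t * g + 1 - exp g ≤ klFun t`, from `1 + u ≤ exp u` at `u = g - log
        -- t`.
        · have := Real.add_one_le_exp (g x - Real.log t)
          rw [Real.exp_sub, Real.exp_log h0, le_div_iff₀ h0] at this
          linarith

end Divergence

/-! ### Uniform mixtures, the chain rule and Fano's inequality -/

section Mixture

variable {ι α β : Type*} [Fintype ι] [MeasurableSpace α] [MeasurableSpace β]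

/-- The uniform mixture of a finite family of measures. -/
def uniformMixture (p : ι → Measure α) : Measure α :=
  (Fintype.card ι : ℝ≥0∞)⁻¹ • ∑ i, p i

lemma uniformMixture_apply (p : ι → Measure α) (s : Set α) :
    uniformMixture p s = (Fintype.card ι : ℝ≥0∞)⁻¹ * ∑ i, p i s := by
  simp [uniformMixture]

lemma uniformMixture_map (p : ι → Measure α) {g : α → β} (hg : Measurable g) :
    uniformMixture (fun i => (p i).map g) = (uniformMixture p).map g := by
  ext s hs
  simp [uniformMixture_apply, Measure.map_apply hg hs]

lemma card_ne_zero_ennreal [Nonempty ι] : (Fintype.card ι : ℝ≥0∞) ≠ 0 := by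
  simp [Fintype.card_ne_zero]

instance isProbabilityMeasure_uniformMixture [Nonempty ι] (p : ι → Measure α)
    [∀ i, IsProbabilityMeasure (p i)] : IsProbabilityMeasure (uniformMixture p) := by
  constructor
  simp [uniformMixture_apply, ENNReal.inv_mul_cancel card_ne_zero_ennreal (ENNReal.natCast_ne_top _)]

lemma uniformMixture_const [Nonempty ι] (p : Measure α) :
    uniformMixture (fun _ : ι => p) = p := by
  ext s hs
  rw [uniformMixture_apply, Finset.sum_const, Finset.card_univ, nsmul_eq_mul, ← mul_assoc,
    ENNReal.inv_mul_cancel card_ne_zero_ennreal (ENNReal.natCast_ne_top _), one_mul]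

/-- The posterior probabilities of the components of a uniform mixture. -/
lemma exists_posterior_weights [Nonempty ι] (p : ι → Measure α)
    [∀ i, IsProbabilityMeasure (p i)] :
    ∃ w : ι → α → ℝ≥0∞, (∀ i, Measurable (w i)) ∧ (∀ a, ∑ i, w i a = 1) ∧
      ∀ i, (uniformMixture p).withDensity (w i) = (Fintype.card ι : ℝ≥0∞)⁻¹ • p i := by
  classical
  let _ : MeasurableSpace ι := ⊤
  have : DiscreteMeasurableSpace ι := ⟨fun _ => trivial⟩
  -- Joint law of observation and index. Conditioning it on the observation gives weights that sum
  -- to 1 everywhere, not just almost everywhere.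
  let J : Measure (α × ι) := uniformMixture fun i => (p i).map fun a => (a, i)
  have hmk (i : ι) : Measurable fun a : α => (a, i) := measurable_id.prodMk measurable_const
  have (i : ι) : IsProbabilityMeasure ((p i).map fun a => (a, i)) :=
    Measure.isProbabilityMeasure_map (hmk i).aemeasurable
  have : IsProbabilityMeasure J := isProbabilityMeasure_uniformMixture _
  have hfst : J.fst = uniformMixture p := by
    rw [Measure.fst, ← uniformMixture_map _ measurable_fst]
    congr 1
    ext1 i
    rw [Measure.map_map measurable_fst (hmk i)]
    exact Measure.map_id
  refine ⟨fun i a => J.condKernel a {i}, fun i => J.condKernel.measurable_coe (.singleton i),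
    fun a => ?_, fun i => ?_⟩
  · rw [← measure_biUnion_finset]
    · have : (⋃ i : ι, ({i} : Set ι)) = univ := iUnion_of_singleton ι
      simp [this]
    · intro i _ j _ hij
      simpa using hij
    · intro i _; exact .singleton i
  · ext s hs
    have := Measure.compProd_apply_prod (μ := J.fst) (κ := J.condKernel) hs (.singleton i)
    rw [withDensity_apply _ hs, ← hfst, ← this, J.disintegrate, uniformMixture_apply]
    simp only [Measure.smul_apply, smul_eq_mul]
    congr 1
    rw [Finset.sum_eq_single i]
    · rw [Measure.map_apply (hmk i) (hs.prod (.singleton i))]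
      congr 1; ext a; simp
    · intro j _ hj
      rw [Measure.map_apply (hmk j) (hs.prod (.singleton i))]
      convert! measure_empty (μ := p j)
      ext a; simp [hj]
    · simp

/-- The predictive kernel: the mixture of finitely many kernels with weights depending on the
source. -/
def weightedKernel (w : ι → α → ℝ≥0∞) (hw : ∀ i, Measurable (w i)) (K : ι → Kernel α β) :
    Kernel α β where
  toFun a := ∑ i, w i a • K i a
  measurable' := by
    refine Measure.measurable_of_measurable_coe _ fun s hs => ?_
    simp only [Measure.coe_finsetSum, Finset.sum_apply, Measure.smul_apply, smul_eq_mul]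
    exact Finset.measurable_sum _ fun i _ => (hw i).mul ((K i).measurable_coe hs)

lemma weightedKernel_apply (w : ι → α → ℝ≥0∞) (hw : ∀ i, Measurable (w i))
    (K : ι → Kernel α β) (a : α) : weightedKernel w hw K a = ∑ i, w i a • K i a := rfl

lemma isMarkovKernel_weightedKernel (w : ι → α → ℝ≥0∞) (hw : ∀ i, Measurable (w i))
    (hw1 : ∀ a, ∑ i, w i a = 1) (K : ι → Kernel α β) [∀ i, IsMarkovKernel (K i)] :
    IsMarkovKernel (weightedKernel w hw K) := by
  refine ⟨fun a => ⟨?_⟩⟩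
  simp [weightedKernel_apply, hw1]

lemma absolutelyContinuous_sum_smul (w : ι → ℝ≥0∞) (ν : ι → Measure α) {i : ι} (hi : w i ≠ 0) :
    ν i ≪ ∑ j, w j • ν j := by
  refine Measure.AbsolutelyContinuous.mk fun s _ h => ?_
  simp only [Measure.coe_finsetSum, Finset.sum_apply, Measure.smul_apply, smul_eq_mul,
    Finset.sum_eq_zero_iff, Finset.mem_univ, true_implies, mul_eq_zero] at h
  exact (h i).resolve_left hi

/-- Bayes' rule `(1/N) p i = w i • mixture` turns the mixture of the extended laws into the mixed
history followed by the predictive kernel, the form that the chain rule needs. -/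
lemma uniformMixture_compProd (p : ι → Measure α)
    [∀ i, IsProbabilityMeasure (p i)] (K : ι → Kernel α β) [∀ i, IsMarkovKernel (K i)]
    (w : ι → α → ℝ≥0∞) (hw : ∀ i, Measurable (w i)) (hw1 : ∀ a, ∑ i, w i a = 1)
    (hwp : ∀ i, (uniformMixture p).withDensity (w i) = (Fintype.card ι : ℝ≥0∞)⁻¹ • p i)
    [SFinite (uniformMixture p)] :
    uniformMixture (fun i => p i ⊗ₘ K i) = uniformMixture p ⊗ₘ weightedKernel w hw K := by
  have := isMarkovKernel_weightedKernel w hw hw1 K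
  ext s hs
  have hg (i : ι) : Measurable fun a => K i a (Prod.mk a ⁻¹' s) :=
    Kernel.measurable_kernel_prodMk_left hs
  rw [Measure.compProd_apply hs, uniformMixture_apply, Finset.mul_sum]
  simp only [weightedKernel_apply, Measure.coe_finsetSum, Finset.sum_apply, Measure.smul_apply,
    smul_eq_mul]
  rw [lintegral_finsetSum (f := fun i a => w i a * K i a (Prod.mk a ⁻¹' s)) _
    fun i _ => (hw i).mul (hg i)]
  refine Finset.sum_congr rfl fun i _ => ?_
  have := lintegral_withDensity_eq_lintegral_mul (uniformMixture p) (hw i) (hg i)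
  simp only [Pi.mul_apply] at this
  rw [← this, hwp, lintegral_smul_measure, Measure.compProd_apply hs, smul_eq_mul]

/-- If the information conveyed by a channel use is at most `C` whatever the prior, then so is the
increment of the information about the mixture component. -/
lemma sum_klDiv_compProd_uniformMixture_le [Nonempty ι]
    [MeasurableSpace.CountableOrCountablyGenerated α β] (p : ι → Measure α)
    [∀ i, IsProbabilityMeasure (p i)] (K : ι → Kernel α β) [∀ i, IsMarkovKernel (K i)]
    {C : ℝ≥0∞} (hC : ∀ a (w : ι → ℝ≥0∞), ∑ i, w i = 1 →
      ∑ i, w i * klDiv (K i a) (∑ j, w j • K j a) ≤ C) :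
    ∑ i, klDiv (p i ⊗ₘ K i) (uniformMixture fun j => p j ⊗ₘ K j) ≤
      ∑ i, klDiv (p i) (uniformMixture p) + Fintype.card ι * C := by
  obtain ⟨w, hw, hw1, hwp⟩ := exists_posterior_weights p
  have := isMarkovKernel_weightedKernel w hw hw1 K
  set Q := weightedKernel w hw K with hQ
  have hcard0 := card_ne_zero_ennreal (ι := ι)
  have hp (i : ι) : p i = (Fintype.card ι : ℝ≥0∞) • (uniformMixture p).withDensity (w i) := by
    rw [hwp, smul_smul, ENNReal.mul_inv_cancel hcard0 (ENNReal.natCast_ne_top _), one_smul]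
  -- `p i`-almost surely the posterior weight of `i` is nonzero, and then `Q a` dominates `K i a`.
  have hac (i : ι) : ∀ᵐ a ∂(p i), K i a ≪ Q a := by
    rw [hp, Measure.ae_ennreal_smul_measure_iff hcard0, ae_withDensity_iff (hw i)]
    exact ae_of_all _ fun a ha => absolutelyContinuous_sum_smul (fun j => w j a) _ ha
  rw [uniformMixture_compProd p K w hw hw1 hwp]
  rw [Finset.sum_congr rfl fun i _ => klDiv_compProd_eq_add (p i) (uniformMixture p) (K i) Q,
    Finset.sum_add_distrib]
  gcongr
  have hterm (i : ι) : klDiv (p i ⊗ₘ K i) (p i ⊗ₘ Q) =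
      Fintype.card ι * ∫⁻ a, w i a * klDiv (K i a) (Q a) ∂(uniformMixture p) := by
    rw [klDiv_compProd_eq_lintegral _ _ _ (hac i)]
    have := lintegral_withDensity_eq_lintegral_mul (uniformMixture p) (hw i)
      (measurable_klDiv_kernel (K i) Q)
    simp only [Pi.mul_apply] at this
    conv_lhs => rw [hp i]
    rw [← this, lintegral_smul_measure, smul_eq_mul]
  simp_rw [hterm]
  rw [← Finset.mul_sum, ← lintegral_finsetSum (f := fun i a => w i a * klDiv (K i a) (Q a)) _
    fun i _ => (hw i).mul (measurable_klDiv_kernel (K i) Q)]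
  gcongr
  calc _ ≤ ∫⁻ _, C ∂(uniformMixture p) := lintegral_mono fun a => hC a _ (hw1 a)
    _ = C := by simp

/-- A form of Fano's inequality for disjoint decoding regions. -/
lemma fano_le_sum_klDiv_uniformMixture [Nonempty ι] (p : ι → Measure α)
    [∀ i, IsProbabilityMeasure (p i)] (E : ι → Set α) (hE : ∀ i, MeasurableSet (E i))
    (hdisj : Pairwise fun i j => Disjoint (E i) (E j)) {a : ℝ}
    (hp : ∀ i, a ≤ (p i).real (E i)) :
    ENNReal.ofReal (a * Real.log (Fintype.card ι) - Real.log 2) * Fintype.card ι ≤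
      ∑ i, klDiv (p i) (uniformMixture p) := by
  classical
  by_cases htop : ∃ i, klDiv (p i) (uniformMixture p) = ∞
  · obtain ⟨i, hi⟩ := htop
    rw [(ENNReal.sum_eq_top).mpr ⟨i, Finset.mem_univ i, hi⟩]
    exact le_top
  push Not at htop
  set q := uniformMixture p with hq
  set N : ℝ := ((Fintype.card ι : ℕ) : ℝ) with hN
  have hN1 : 1 ≤ N := by
    rw [hN]; exact_mod_cast Fintype.card_pos
  have hlog : 0 ≤ Real.log N := Real.log_nonneg hN1
  have key (i : ι) : a * Real.log N - Real.log 2 + 1 - (1 + (N - 1) * q.real (E i)) / 2 ≤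
      (klDiv (p i) q).toReal := by
    -- `exp g` is `N / 2` on `E i` and `1 / 2` elsewhere. As the `q (E i)` sum to at most 1, the
    -- exponential terms sum to at most `N - 1/2`, less than the `N` contributed by the constants 1.
    let g : α → ℝ := fun x => (E i).indicator (fun _ => Real.log N) x - Real.log 2
    have hg : Measurable g := (measurable_const.indicator (hE i)).sub measurable_const
    have hb : ∀ x, |g x| ≤ Real.log N + Real.log 2 := fun x => by
      have h2 : 0 < Real.log 2 := Real.log_pos one_lt_two
      by_cases hx : x ∈ E i
      · simp only [g, indicator_of_mem hx]
        rw [abs_le]; constructor <;> linarith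
      · simp only [g, indicator_of_notMem hx]
        rw [abs_le]; constructor <;> linarith
    have h := integral_sub_integral_exp_le_klDiv (p i) q (htop i) hg hb
    have h1 : ∫ x, g x ∂(p i) = (p i).real (E i) * Real.log N - Real.log 2 := by
      simp only [g]
      rw [integral_sub ((integrable_const _).indicator (hE i)) (integrable_const _),
        integral_indicator_const _ (hE i)]
      simp
    have h2 : ∫ x, Real.exp (g x) ∂q = (1 + (N - 1) * q.real (E i)) / 2 := by
      have : (fun x => Real.exp (g x)) =
          fun x => 1 / 2 + (E i).indicator (fun _ => (N - 1) / 2) x := by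
        ext x
        by_cases hx : x ∈ E i
        · simp only [g, indicator_of_mem hx]
          rw [Real.exp_sub, Real.exp_log (by linarith), Real.exp_log two_pos]; ring
        · simp only [g, indicator_of_notMem hx]
          rw [Real.exp_sub, Real.exp_log two_pos]; simp
      rw [this, integral_add (integrable_const _) ((integrable_const _).indicator (hE i)),
        integral_indicator_const _ (hE i)]
      simp; ring
    rw [h1, h2] at h
    have := mul_le_mul_of_nonneg_right (hp i) hlog
    linarith
  have hsum : ∑ i, q.real (E i) ≤ 1 := by
    rw [← measureReal_biUnion_finset (fun i _ j _ hij => hdisj hij) (fun i _ => hE i)]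
    exact measureReal_le_one
  have hfin : ∑ i, klDiv (p i) q = ENNReal.ofReal (∑ i, (klDiv (p i) q).toReal) := by
    rw [ENNReal.ofReal_sum_of_nonneg fun i _ => ENNReal.toReal_nonneg]
    exact Finset.sum_congr rfl fun i _ => (ENNReal.ofReal_toReal (htop i)).symm
  rw [hfin, ← ENNReal.ofReal_natCast, ← ENNReal.ofReal_mul' (Nat.cast_nonneg _)]
  refine ENNReal.ofReal_le_ofReal ?_
  refine le_trans ?_ (Finset.sum_le_sum fun i _ => key i)
  have hexp : ∑ i, (a * Real.log N - Real.log 2 + 1 - (1 + (N - 1) * q.real (E i)) / 2) =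
      N * (a * Real.log N - Real.log 2 + 1 / 2) - (N - 1) / 2 * ∑ i, q.real (E i) := by
    rw [Finset.mul_sum]
    simp_rw [show ∀ i, a * Real.log N - Real.log 2 + 1 - (1 + (N - 1) * q.real (E i)) / 2 =
      (a * Real.log N - Real.log 2 + 1 / 2) - (N - 1) / 2 * q.real (E i) from fun i => by ring]
    rw [Finset.sum_sub_distrib, Finset.sum_const, Finset.card_univ, nsmul_eq_mul]
  rw [hexp]
  have := mul_le_mul_of_nonneg_left hsum (by linarith : 0 ≤ (N - 1) / 2)
  linarith

end Mixture

/-! ### The oracle as a channel and its capacity -/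

section Capacity

variable {n : ℕ} {Y : Type*} [MeasurableSpace Y] {P : ProblemClass n Y}
  {U : Type*} [MeasurableSpace U]

lemma sum_smul_dirac_ae {α ι : Type*} [Fintype ι] [MeasurableSpace α]
    [MeasurableSingletonClass α] (w : ι → ℝ≥0∞) (u : ι → α) {p : α → Prop}
    (h : ∀ i, w i ≠ 0 → p (u i)) : ∀ᵐ a ∂(∑ i, w i • Measure.dirac (u i)), p a := by
  rw [ae_iff]
  simp only [Measure.coe_finsetSum, Finset.sum_apply, Measure.smul_apply, smul_eq_mul,
    Measure.dirac_apply]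
  refine Finset.sum_eq_zero fun i _ => ?_
  by_cases hi : w i = 0
  · simp [hi]
  · rw [indicator_of_notMem (by simpa using h i hi), mul_zero]

lemma lintegral_sum_smul_dirac {α ι : Type*} [Fintype ι] [MeasurableSpace α]
    [MeasurableSingletonClass α] (w : ι → ℝ≥0∞) (u : ι → α) (g : α → ℝ≥0∞) :
    ∫⁻ a, g a ∂(∑ i, w i • Measure.dirac (u i)) = ∑ i, w i * g (u i) := by
  simp [lintegral_finsetSum_measure]

/-- The random transformation `u ↦ Φ(u, W)` as a Markov kernel. -/
def ProblemClass.Realization.channel (R : P.Realization U) : Kernel U Y :=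
  (Kernel.id ×ₖ Kernel.const U (volume : Measure I)).map R.Φ

namespace ProblemClass.Realization

instance isMarkovKernel_channel (R : P.Realization U) : IsMarkovKernel R.channel :=
  Kernel.IsMarkovKernel.map _ R.measurable_Φ

lemma channel_apply (R : P.Realization U) (u : U) :
    R.channel u = (volume : Measure I).map fun w => R.Φ (u, w) := by
  rw [channel, Kernel.map_apply _ R.measurable_Φ, Kernel.prod_apply, Kernel.id_apply,
    Kernel.const_apply, Measure.dirac_prod, Measure.map_map R.measurable_Φ measurable_prodMk_left]
  rfl

lemma oracle_eq_channel (R : P.Realization U) (z : P.instances × P.domain) :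
    P.oracle z = R.channel (R.ψ z) := by
  rw [R.oracle_eq, channel_apply]

lemma map_prod_volume_eq_compProd (R : P.Realization U) (μ : Measure (range R.ψ))
    [IsProbabilityMeasure μ] :
    (μ.prod (volume : Measure I)).map
      (fun p : range R.ψ × I => ((p.1 : U), R.Φ ((p.1 : U), p.2))) =
      (μ.map Subtype.val) ⊗ₘ R.channel := by
  have hg : Measurable fun p : range R.ψ × I => ((p.1 : U), R.Φ ((p.1 : U), p.2)) := by
    have := R.measurable_Φ
    fun_prop
  have : IsProbabilityMeasure (μ.map (Subtype.val : range R.ψ → U)) :=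
    Measure.isProbabilityMeasure_map measurable_subtype_coe.aemeasurable
  ext s hs
  rw [Measure.map_apply hg hs, Measure.prod_apply (hg hs), Measure.compProd_apply hs,
    lintegral_map (Kernel.measurable_kernel_prodMk_left hs) measurable_subtype_coe]
  refine lintegral_congr fun a => ?_
  have hΦ : Measurable fun w => R.Φ ((a : U), w) := R.measurable_Φ.comp measurable_prodMk_left
  rw [channel_apply, Measure.map_apply hΦ (measurable_prodMk_left hs)]
  rfl

/-- The information between a finitely supported input and the oracle's response is bounded by
the capacity. -/
lemma sum_mul_klDiv_oracle_le_capacity [StandardBorelSpace Y] [StandardBorelSpace U]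
    (R : P.Realization U) {ι : Type*} [Fintype ι] (z : ι → P.instances × P.domain)
    (w : ι → ℝ≥0∞) (hw : ∑ i, w i = 1) :
    ∑ i, w i * klDiv (P.oracle (z i)) (∑ j, w j • P.oracle (z j)) ≤ R.capacity := by
  let u (i : ι) : range R.ψ := ⟨R.ψ (z i), mem_range_self _⟩
  let μ : Measure (range R.ψ) := ∑ i, w i • Measure.dirac (u i)
  have hμ : IsProbabilityMeasure μ := ⟨by simp [μ, hw]⟩
  -- The same input law seen on all of `U`, where the channel kernel lives.
  let μ' : Measure U := ∑ i, w i • Measure.dirac (R.ψ (z i))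
  have hμ' : μ.map Subtype.val = μ' := by
    ext s hs
    simp [μ, μ', u, Measure.map_apply measurable_subtype_coe hs,
      Measure.dirac_apply' _ (measurable_subtype_coe hs), Measure.dirac_apply' _ hs, indicator]
    rfl
  have : IsProbabilityMeasure μ' := ⟨by simp [μ', hw]⟩
  let Q : Measure Y := ∑ j, w j • P.oracle (z j)
  have hQ : IsProbabilityMeasure Q := ⟨by simp [Q, hw]⟩
  have hsnd : (μ' ⊗ₘ R.channel).snd = Q := by
    rw [Measure.snd_compProd]
    ext s hs
    rw [Measure.bind_apply hs R.channel.measurable.aemeasurable, lintegral_sum_smul_dirac]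
    simp [Q, oracle_eq_channel R]
  have hac : ∀ᵐ a ∂μ', R.channel a ≪ Kernel.const U Q a :=
    sum_smul_dirac_ae _ _ fun i hi => by
      rw [Kernel.const_apply, ← oracle_eq_channel]
      exact absolutelyContinuous_sum_smul w (fun j => P.oracle (z j)) hi
  refine le_trans (le_of_eq ?_) (le_iSup₂ (f := fun (μ : Measure (range R.ψ))
    (_ : IsProbabilityMeasure μ) => mutualInfo ((μ.prod (volume : Measure I)).map
      (fun p : range R.ψ × I => ((p.1 : U), R.Φ ((p.1 : U), p.2))))) μ hμ)
  rw [R.map_prod_volume_eq_compProd μ, hμ', mutualInfo, Measure.fst_compProd, hsnd,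
    ← Measure.compProd_const, klDiv_compProd_eq_lintegral _ _ _ hac, lintegral_sum_smul_dirac]
  simp [Q, oracle_eq_channel R]

end ProblemClass.Realization

end Capacity

/-! ### Information gathered by an algorithm -/

namespace ProblemClass

variable {n : ℕ} {Y : Type*} [MeasurableSpace Y] {P : ProblemClass n Y}
  {U : Type*} [MeasurableSpace U] {T : ℕ}

namespace Algorithm

lemma measurable_snoc_step (A : P.Algorithm T) (t : ℕ) (ht : t < T + 1) :
    Measurable fun p : (Fin t → P.domain × Y) × Y =>
      (Fin.snoc (α := fun _ => P.domain × Y) p.1 (A.step ⟨t, ht⟩ p.1, p.2) :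
        Fin (t + 1) → P.domain × Y) := by
  have hA := A.measurable_step ⟨t, ht⟩
  refine measurable_pi_lambda _ fun i => ?_
  refine Fin.lastCases ?_ (fun j => ?_) i
  · simp only [Fin.snoc_last]
    exact (hA.comp measurable_fst).prodMk measurable_snd
  · simp only [Fin.snoc_castSucc]
    exact (measurable_pi_apply j).comp measurable_fst

instance isProbabilityMeasure_historyLaw (A : P.Algorithm T) (f : P.instances) (t : ℕ)
    (ht : t ≤ T) : IsProbabilityMeasure (A.historyLaw f t ht) := by
  induction t with
  | zero => rw [historyLaw]; infer_instance
  | succ t ih =>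
    rw [historyLaw]
    have := ih (by omega)
    exact Measure.isProbabilityMeasure_map (A.measurable_snoc_step t (by omega)).aemeasurable

instance isProbabilityMeasure_outputLaw (A : P.Algorithm T) (f : P.instances) :
    IsProbabilityMeasure (A.outputLaw f) :=
  Measure.isProbabilityMeasure_map (A.measurable_step _).aemeasurable

variable [StandardBorelSpace Y] [StandardBorelSpace U]

/-- Each query conveys at most `R.capacity` nats about the instance. -/
lemma sum_klDiv_historyLaw_le (R : P.Realization U) (A : P.Algorithm T) {ι : Type*} [Fintype ι]
    [Nonempty ι] (f : ι → P.instances) (t : ℕ) (ht : t ≤ T) :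
    ∑ i, klDiv (A.historyLaw (f i) t ht) (uniformMixture fun j => A.historyLaw (f j) t ht) ≤
      t * (Fintype.card ι * R.capacity) := by
  induction t with
  | zero => simp [historyLaw, uniformMixture_const]
  | succ t ih =>
    have hg := A.measurable_snoc_step t (by omega)
    simp only [historyLaw]
    rw [uniformMixture_map _ hg]
    -- Appending the query and response is one map for all instances, so data processing applies.
    refine (Finset.sum_le_sum fun i _ => klDiv_map_le _ _ hg).trans ?_
    refine (sum_klDiv_compProd_uniformMixture_le _ (fun i => A.response (f i) t (by omega))
      (C := R.capacity) fun a w hw => ?_).trans ?_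
    · exact R.sum_mul_klDiv_oracle_le_capacity (fun i => (f i, A.step ⟨t, by omega⟩ a)) w hw
    · push_cast
      rw [add_mul, one_mul]
      gcongr
      exact ih (by omega)

/-- The information-theoretic lower bound for an algorithm that identifies the instance. -/
lemma fano_le_mul_capacity (R : P.Realization U) (A : P.Algorithm T) {ι : Type*} [Fintype ι]
    [Nonempty ι] (f : ι → P.instances) (E : ι → Set P.domain) (hE : ∀ i, MeasurableSet (E i))
    (hdisj : Pairwise fun i j => Disjoint (E i) (E j)) {a : ℝ}
    (ha : ∀ i, a ≤ (A.outputLaw (f i)).real (E i)) :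
    ENNReal.ofReal (a * Real.log (Fintype.card ι) - Real.log 2) ≤ T * R.capacity := by
  have h := fano_le_sum_klDiv_uniformMixture (fun i => A.outputLaw (f i)) E hE hdisj ha
  have hstep := A.measurable_step (Fin.last T)
  have h2 : ∑ i, klDiv (A.outputLaw (f i)) (uniformMixture fun j => A.outputLaw (f j)) ≤
      T * (Fintype.card ι * R.capacity) := by
    refine le_trans ?_ (A.sum_klDiv_historyLaw_le R f T le_rfl)
    simp only [outputLaw]
    rw [uniformMixture_map _ hstep]
    exact Finset.sum_le_sum fun i _ => klDiv_map_le _ _ hstep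
  have h3 := h.trans h2
  rw [← mul_assoc, mul_comm (T : ℝ≥0∞), mul_assoc, mul_comm] at h3
  exact (ENNReal.mul_le_mul_iff_right card_ne_zero_ennreal (ENNReal.natCast_ne_top _)).mp h3

end Algorithm

lemma measurable_err (f : P.instances) : Measurable (P.err f) :=
  (f.1.continuous.measurable).sub_const _

lemma err_nonneg (f : P.instances) (x : P.domain) : 0 ≤ P.err f x := by
  have : CompactSpace P.domain := isCompact_iff_compactSpace.mp P.isCompact_domain
  exact sub_nonneg.mpr (ciInf_le (isCompact_range f.1.continuous).bddBelow x)

lemma Algorithm.prob_le_of_lintegral_lt (A : P.Algorithm T) (f : P.instances) {r ε : ℝ}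
    (hε : 0 < ε)
    (hA : ∫⁻ x, ENNReal.ofReal (P.err f x ^ r) ∂(A.outputLaw f) ≤ ENNReal.ofReal ε) :
    A.outputLaw f {x | 3 * ε ≤ P.err f x ^ r} ≤ ENNReal.ofReal (1 / 3) := by
  have hm : Measurable fun x => ENNReal.ofReal (P.err f x ^ r) :=
    ((measurable_err f).pow_const r).ennreal_ofReal
  have hsub : {x | 3 * ε ≤ P.err f x ^ r} ⊆
      {x | ENNReal.ofReal (3 * ε) ≤ ENNReal.ofReal (P.err f x ^ r)} :=
    fun x hx => ENNReal.ofReal_le_ofReal hx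
  refine (measure_mono hsub).trans ((meas_ge_le_lintegral_div hm.aemeasurable
    (by simpa using hε) ENNReal.ofReal_ne_top).trans ?_)
  refine (ENNReal.div_le_div_right hA _).trans ?_
  rw [← ENNReal.ofReal_div_of_pos (by linarith)]
  refine ENNReal.ofReal_le_ofReal (le_of_eq ?_)
  field_simp

variable [StandardBorelSpace Y] [StandardBorelSpace U]

/-- The near-minimizer sets serve as decoding regions. Assuming their disjointness directly, without
`d`, lets both the packing and the grid use this bound. -/
lemma Algorithm.log_card_le_of_prob_le (R : P.Realization U) (A : P.Algorithm T) {ι : Type*}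
    [Fintype ι] [Nonempty ι] (f : ι → P.instances) {r ε δ : ℝ} (hr : 0 < r) (hε : 0 < ε)
    (hδ : 0 ≤ δ)
    (hsep : ∀ i j, i ≠ j → ∀ x, P.err (f i) x < ε ^ (1 / r) → ¬ P.err (f j) x < ε ^ (1 / r))
    (hA : ∀ i, A.outputLaw (f i) {x | ε ≤ P.err (f i) x ^ r} ≤ ENNReal.ofReal δ) :
    ENNReal.ofReal ((1 - δ) * Real.log (Fintype.card ι) - Real.log 2) ≤ T * R.capacity := by
  have hE (i : ι) : MeasurableSet {x | P.err (f i) x < ε ^ (1 / r)} :=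
    measurableSet_lt (measurable_err _) measurable_const
  refine A.fano_le_mul_capacity R f (fun i => {x | P.err (f i) x < ε ^ (1 / r)}) hE ?_ fun i => ?_
  · intro i j hij
    exact Set.disjoint_left.mpr fun x hx hx' => hsep i j hij x hx hx'
  · have hcompl : {x | ε ≤ P.err (f i) x ^ r} = {x | P.err (f i) x < ε ^ (1 / r)}ᶜ := by
      ext x
      simp only [mem_ofPred_eq, mem_compl_iff, not_lt, one_div]
      exact (Real.rpow_inv_le_iff_of_pos hε.le (err_nonneg _ _) hr).symm
    have h := hA i
    rw [hcompl] at h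
    have h1 : (A.outputLaw (f i)).real {x | P.err (f i) x < ε ^ (1 / r)}ᶜ ≤ δ :=
      ENNReal.toReal_le_of_le_ofReal hδ h
    rw [probReal_compl_eq_one_sub (hE i)] at h1
    linarith

end ProblemClass

/-! ### From finite packings to the packing number -/

/-- Finite packings suffice even when `N = ∞`: the bounds for finite `k` are then unbounded and
force `B = ∞`. -/
lemma fanoBracket_le {a : ℝ} (ha : 0 < a) (N : ℕ∞) {B : ℝ≥0∞}
    (h : ∀ k : ℕ, 1 ≤ k → (k : ℕ∞) ≤ N → ENNReal.ofReal (a * Real.log k - Real.log 2) ≤ B) :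
    fanoBracket a N ≤ B := by
  have hbr (k : ℕ) (hk : 1 ≤ k) :
      fanoBracket a k = ENNReal.ofReal (a * Real.log k - Real.log 2) := by
    have : ENNReal.log ((k : ℕ∞) : ℝ≥0∞) = (Real.log k : EReal) := by
      rw [ENat.toENNReal_coe, ← ENNReal.ofReal_natCast,
        ENNReal.log_ofReal_of_pos (by exact_mod_cast hk)]
    rw [fanoBracket, this]
    norm_cast
  induction N using ENat.recTopCoe with
  | top =>
    suffices hB : B = ∞ by simp [hB]
    by_contra hB
    obtain ⟨k, hk⟩ := exists_nat_gt (Real.exp ((B.toReal + Real.log 2 + 1) / a))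
    have hk0 : (0 : ℝ) < k := (Real.exp_pos _).trans hk
    have hk1 : 1 ≤ k := by exact_mod_cast hk0
    have h2 := ENNReal.toReal_mono hB (h k hk1 le_top)
    rw [ENNReal.toReal_ofReal'] at h2
    replace h2 := (le_max_left _ _).trans h2
    have h3 := (Real.lt_log_iff_exp_lt hk0).mpr hk
    rw [div_lt_iff₀ ha] at h3
    linarith
  | coe m =>
    rcases Nat.eq_zero_or_pos m with rfl | hm
    -- `N = 0` is the packing number of an empty class; here `log 0 = ⊥`, truncated to 0.
    · have : fanoBracket a (0 : ℕ) = 0 := by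
        rw [fanoBracket]
        simp [EReal.coe_mul_bot_of_pos ha]
      rw [this]
      exact zero_le
    · rw [hbr m hm]
      exact h m hm le_rfl

lemma exists_packing_of_le_packingNumber {α : Type*} {d : α → α → ℝ} {η : ℝ} {k : ℕ}
    (hk : 1 ≤ k) (h : (k : ℕ∞) ≤ packingNumber d η) :
    ∃ f : Fin k → α, ∀ i j, i ≠ j → 2 * η ≤ d (f i) (f j) := by
  -- The supremum may be infinite and not attained; a strict bound below it yields a packing of size
  -- at least `k`, which is then restricted.
  have hlt : ((k - 1 : ℕ) : ℕ∞) < packingNumber d η :=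
    lt_of_lt_of_le (by exact_mod_cast Nat.sub_lt hk one_pos) h
  simp only [packingNumber, lt_iSup_iff] at hlt
  obtain ⟨N, ⟨_, f, hf⟩, hN⟩ := hlt
  have hkN : k ≤ N := by
    have : k - 1 < N := by exact_mod_cast hN
    omega
  exact ⟨fun i => f (Fin.castLE hkN i), fun i j hij =>
    hf _ _ fun he => hij (Fin.castLE_injective hkN he)⟩

lemma ProblemClass.IsSeparating.not_err_lt {n : ℕ} {Y : Type*} [MeasurableSpace Y]
    {P : ProblemClass n Y} {d : P.instances → P.instances → ℝ} (hd : P.IsSeparating d) {η : ℝ}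
    (hη : 0 < η) {f g : P.instances} (hfg : 2 * η ≤ d f g) (x : P.domain)
    (hx : P.err f x < η) : ¬ P.err g x < η := by
  have := hd f g x η hη hfg (by rw [ProblemClass.err] at hx; linarith)
  rw [ProblemClass.err]
  linarith

/-! ### Grids and distance functions on the cube -/

section Cube

variable {n : ℕ}

/-- The point of the regular grid of spacing `h` in the cube `[-1, 1]ⁿ` with the given indices. -/
def gridPoint (h : ℝ) {m : ℕ} (k : Fin n → Fin m) : EuclideanSpace ℝ (Fin n) :=
  WithLp.toLp 2 fun i => -1 + h * (k i : ℕ)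

lemma abs_gridPoint_le {h : ℝ} (hh : 0 ≤ h) {m : ℕ} (hm : h * (m - 1) ≤ 2)
    (k : Fin n → Fin m) (i : Fin n) : |gridPoint h k i| ≤ 1 := by
  have h1 : ((k i : ℕ) : ℝ) ≤ m - 1 := by
    have : ((k i : ℕ) : ℝ) + 1 ≤ m := by exact_mod_cast (k i).2
    linarith
  have h2 := mul_le_mul_of_nonneg_left h1 hh
  have h3 : 0 ≤ h * ((k i : ℕ) : ℝ) := by positivity
  simp only [gridPoint]
  rw [abs_le]
  constructor <;> linarith

lemma le_dist_gridPoint {h : ℝ} (hh : 0 ≤ h) {m : ℕ} {k l : Fin n → Fin m} (hkl : k ≠ l) :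
    h ≤ dist (gridPoint h k) (gridPoint h l) := by
  obtain ⟨i, hi⟩ := Function.ne_iff.mp hkl
  have h1 : |gridPoint h k i - gridPoint h l i| ≤ dist (gridPoint h k) (gridPoint h l) := by
    rw [dist_eq_norm]
    exact PiLp.norm_apply_le (gridPoint h k - gridPoint h l) i
  refine le_trans ?_ h1
  have h2 : gridPoint h k i - gridPoint h l i = h * (((k i : ℕ) : ℤ) - ((l i : ℕ) : ℤ) : ℤ) := by
    simp only [gridPoint]; push_cast; ring
  rw [h2, abs_mul, abs_of_nonneg hh]
  have h3 : (1 : ℝ) ≤ |((((k i : ℕ) : ℤ) - ((l i : ℕ) : ℤ) : ℤ) : ℝ)| := by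
    rw [← Int.cast_abs]
    have h4 : ((k i : ℕ) : ℤ) - ((l i : ℕ) : ℤ) ≠ 0 :=
      sub_ne_zero.mpr fun he => hi (Fin.ext (Int.ofNat_inj.mp he))
    have h5 : ((1 : ℤ) : ℝ) ≤ ((|((k i : ℕ) : ℤ) - ((l i : ℕ) : ℤ)| : ℤ) : ℝ) :=
      Int.cast_le.mpr (Int.one_le_abs h4)
    rwa [Int.cast_one] at h5
  nlinarith

/-- The distance to a fixed point as a continuous function on a set. -/
def distTo (X : Set (EuclideanSpace ℝ (Fin n))) (a : EuclideanSpace ℝ (Fin n)) : C(X, ℝ) :=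
  ⟨fun x => dist (x : EuclideanSpace ℝ (Fin n)) a, by fun_prop⟩

lemma isConvexFun_distTo (X : Set (EuclideanSpace ℝ (Fin n))) (a : EuclideanSpace ℝ (Fin n)) :
    IsConvexFun (distTo X a) := by
  intro x y z s t hs ht hst hz
  have h := (convexOn_univ_dist a).2 (mem_univ (x : EuclideanSpace ℝ (Fin n)))
    (mem_univ (y : EuclideanSpace ℝ (Fin n))) hs ht hst
  rw [← hz] at h
  exact h

lemma lipschitzWith_distTo (X : Set (EuclideanSpace ℝ (Fin n)))
    (a : EuclideanSpace ℝ (Fin n)) : LipschitzWith 1 (distTo X a) := by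
  have h := (LipschitzWith.dist_left a).comp (LipschitzWith.subtype_val X)
  rw [one_mul] at h
  exact h

variable {Y : Type*} [MeasurableSpace Y]

lemma ProblemClass.err_distTo {P : ProblemClass n Y} {a : EuclideanSpace ℝ (Fin n)}
    (ha : a ∈ P.domain) (hf : distTo P.domain a ∈ P.instances) (x : P.domain) :
    P.err ⟨distTo P.domain a, hf⟩ x = dist (x : EuclideanSpace ℝ (Fin n)) a := by
  have hmin : P.minVal ⟨distTo P.domain a, hf⟩ = 0 := by
    refine le_antisymm ?_ (Real.iInf_nonneg fun x =>
      dist_nonneg (x := (x : EuclideanSpace ℝ (Fin n))) (y := a))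
    refine (ciInf_le ⟨0, ?_⟩ (⟨a, ha⟩ : P.domain)).trans (dist_self a).le
    rintro _ ⟨y, rfl⟩
    exact dist_nonneg (x := (y : EuclideanSpace ℝ (Fin n))) (y := a)
  rw [ProblemClass.err, hmin, sub_zero]
  rfl

end Cube

/-- The logarithm of the size of a grid with at least `1 / (3 ε)` points per coordinate. -/
lemma le_fano_of_grid {n : ℕ} (hn : 1 ≤ n) {m : ℕ} {ε : ℝ} (hε : 0 < ε) (hε' : ε ≤ 1 / 64)
    (hm : 1 / (3 * ε) ≤ m) :
    1 / 6 * n * Real.log (1 / ε) ≤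
      (1 - 1 / 3) * Real.log ((m ^ n : ℕ) : ℝ) - Real.log 2 := by
  have hn' : (1 : ℝ) ≤ n := by exact_mod_cast hn
  set L := Real.log (1 / ε) with hL
  -- `1/64 = 2^(-6)`. Hence `log 3 ≤ L / 3` and `log m ≥ 2 L / 3`, and `4/9 - 1/6 ≥ 1/6` concludes.
  have h64 : 6 * Real.log 2 ≤ L := by
    have h1 : Real.log ((2 : ℝ) ^ 6) ≤ L := by
      refine Real.log_le_log (by norm_num) ?_
      rw [le_div_iff₀ hε]; linarith
    rw [Real.log_pow] at h1
    exact_mod_cast h1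
  have h3 : Real.log 3 ≤ 2 * Real.log 2 := by
    have : Real.log 3 ≤ Real.log ((2 : ℝ) ^ 2) := Real.log_le_log (by norm_num) (by norm_num)
    rw [Real.log_pow] at this
    exact_mod_cast this
  have h2 : 0 < Real.log 2 := Real.log_pos one_lt_two
  have hlogm : L - Real.log 3 ≤ Real.log m := by
    refine le_trans (le_of_eq ?_) (Real.log_le_log (by positivity) hm)
    rw [hL, ← Real.log_div (by positivity) (by norm_num)]
    congr 1
    field_simp
  rw [Nat.cast_pow, Real.log_pow]
  have h4 : (2 / 3 : ℝ) * L ≤ Real.log m := by linarith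
  have h5 := mul_le_mul_of_nonneg_left h4 (by linarith : (0 : ℝ) ≤ n)
  have h6 := mul_le_mul_of_nonneg_right hn' (by linarith : 0 ≤ L)
  nlinarith

/-! ### The complexity lower bounds -/

theorem theorem1 :
    (∀ (n : ℕ) (Y U : Type*) [MeasurableSpace Y] [StandardBorelSpace Y]
        [MeasurableSpace U] [StandardBorelSpace U]
        (P : ProblemClass n Y) (R : P.Realization U)
        (d : P.instances → P.instances → ℝ), P.IsSeparating d →
        ∀ r ε : ℝ, 1 ≤ r → 0 < ε → 4 < packingNumber d (ε ^ (1 / r)) →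
          (∀ δ : ℝ, 0 < δ → δ < 1 / 2 →
            fanoBracket (1 - δ) (packingNumber d (ε ^ (1 / r))) / R.capacity
              ≤ (P.probComplexity r ε δ : ℝ≥0∞)) ∧
          fanoBracket (2 / 3) (packingNumber d ((3 * ε) ^ (1 / r))) / R.capacity
            ≤ (P.meanComplexity r ε : ℝ≥0∞)) ∧
    (∃ c ε₀ : ℝ, 0 < c ∧ 0 < ε₀ ∧ ε₀ < 1 ∧
      ∀ (n : ℕ) (Y U : Type*) [MeasurableSpace Y] [StandardBorelSpace Y]
        [MeasurableSpace U] [StandardBorelSpace U]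
        (P : ProblemClass n Y) (R : P.Realization U),
        P.domain = {x | ∀ i, |x i| ≤ 1} →
        P.instances = {f : C(P.domain, ℝ) | IsConvexFun f ∧ LipschitzWith 1 f} →
        ∀ ε : ℝ, 0 < ε → ε ≤ ε₀ →
          ENNReal.ofReal (c * n * Real.log (1 / ε)) / R.capacity
            ≤ (P.meanComplexity 1 ε : ℝ≥0∞)) := by
  refine ⟨fun n Y U _ _ _ _ P R d hd r ε hr hε _ => ?_, 1 / 6, 1 / 64, by norm_num, by norm_num,
    by norm_num, fun n Y U _ _ _ _ P R hdom hinst ε hε hε' => ?_⟩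
  · have hr0 : 0 < r := by linarith
    have key (T : ℕ) (A : P.Algorithm T) (ε' δ : ℝ) (hε' : 0 < ε') (hδ : 0 ≤ δ) (hδ' : δ < 1)
        (hA : ∀ f, A.outputLaw f {x | ε' ≤ P.err f x ^ r} ≤ ENNReal.ofReal δ) :
        fanoBracket (1 - δ) (packingNumber d (ε' ^ (1 / r))) ≤ T * R.capacity := by
      refine fanoBracket_le (by linarith) _ fun k hk hkN => ?_
      obtain ⟨f, hf⟩ := exists_packing_of_le_packingNumber hk hkN
      have : Nonempty (Fin k) := ⟨⟨0, hk⟩⟩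
      have h := A.log_card_le_of_prob_le R f hr0 hε' hδ
        (fun i j hij x => hd.not_err_lt (Real.rpow_pos_of_pos hε' _) (hf i j hij) x)
        fun i => hA (f i)
      rwa [Fintype.card_fin] at h
    refine ⟨fun δ hδ hδ' => ?_, ?_⟩
    · simp only [ProblemClass.probComplexity, ENat.toENNReal_iInf]
      -- Division in `ℝ≥0∞` makes capacities `0` and `∞` need no separate case.
      refine le_iInf₂ fun T hT => ENNReal.div_le_of_le_mul ?_
      obtain ⟨_, A, hA⟩ := hT
      rw [iSup_le_iff] at hA
      exact key T A ε δ hε hδ.le (by linarith) hA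
    · simp only [ProblemClass.meanComplexity, ENat.toENNReal_iInf]
      refine le_iInf₂ fun T hT => ENNReal.div_le_of_le_mul ?_
      obtain ⟨_, A, hA⟩ := hT
      have h := key T A (3 * ε) (1 / 3) (by linarith) (by norm_num) (by norm_num) fun f =>
        A.prob_le_of_lintegral_lt f hε ((le_iSup (fun f : P.instances =>
          ∫⁻ x, ENNReal.ofReal (P.err f x ^ r) ∂(A.outputLaw f)) f).trans hA.le)
      norm_num at h ⊢
      exact h
  · rcases Nat.eq_zero_or_pos n with rfl | hn
    · simp
    simp only [ProblemClass.meanComplexity, ENat.toENNReal_iInf]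
    refine le_iInf₂ fun T hT => ENNReal.div_le_of_le_mul ?_
    obtain ⟨_, A, hA⟩ := hT
    -- Spacing `6 ε` makes the balls of radius `3 ε`, the Markov level, disjoint; `m - 1` steps of
    -- that length fit in the side length 2.
    set m : ℕ := ⌊1 / (3 * ε)⌋₊ + 1 with hm
    have hm1 : 1 / (3 * ε) ≤ m := by
      rw [hm]; push_cast; exact (Nat.lt_floor_add_one _).le
    have hm2 : 6 * ε * ((m : ℝ) - 1) ≤ 2 := by
      have h1 : ((⌊1 / (3 * ε)⌋₊ : ℕ) : ℝ) ≤ 1 / (3 * ε) := Nat.floor_le (by positivity)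
      have h2 := mul_le_mul_of_nonneg_left h1 (by linarith : 0 ≤ 6 * ε)
      have h3 : 6 * ε * (1 / (3 * ε)) = 2 := by field_simp; norm_num
      rw [hm]; push_cast
      linarith
    have hmem (k : Fin n → Fin m) : gridPoint (6 * ε) k ∈ P.domain := by
      rw [hdom]
      exact abs_gridPoint_le (by linarith) hm2 k
    have hins (a : EuclideanSpace ℝ (Fin n)) : distTo P.domain a ∈ P.instances := by
      rw [hinst]
      exact ⟨isConvexFun_distTo _ a, lipschitzWith_distTo _ a⟩
    have h := A.log_card_le_of_prob_le R
      (fun k : Fin n → Fin m => (⟨distTo P.domain (gridPoint (6 * ε) k), hins _⟩ : P.instances))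
      (r := 1) (ε := 3 * ε) (δ := 1 / 3) one_pos (by linarith) (by norm_num) ?_ fun k =>
        A.prob_le_of_lintegral_lt _ hε ((le_iSup (fun f : P.instances =>
          ∫⁻ x, ENNReal.ofReal (P.err f x ^ (1 : ℝ)) ∂(A.outputLaw f)) _).trans hA.le)
    · refine (ENNReal.ofReal_le_ofReal ?_).trans h
      rw [Fintype.card_fun, Fintype.card_fin, Fintype.card_fin]
      exact le_fano_of_grid hn hε hε' hm1
    · intro k l hkl x hx hx'
      rw [ProblemClass.err_distTo (hmem _)] at hx hx'
      have h1 := le_dist_gridPoint (by linarith : 0 ≤ 6 * ε) hkl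
      have h2 := dist_triangle_left (gridPoint (6 * ε) k) (gridPoint (6 * ε) l)
        (x : EuclideanSpace ℝ (Fin n))
      norm_num at hx hx'
      linarith

end
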